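/- Let $A=\{\mathbf a_1,\dots,\mathbf a_m\}\subseteq\mathbb Z^n$ be linearly independent over $\mathbb R$, and let $\mathbf a_0\in\mathbb Z^n$ lie in the (relative) interior of the convex hull of $A$; equivalently, there are positive integers $\ell_0,\ell_1,\dots,\ell_m$ with greatest common divisor $1$ such that $\ell_0\mathbf a_0=\sum_{j=1}^m\ell_j\mathbf a_j$ and $\ell_0=\sum_{j=1}^m\ell_j$. Put $f_\lambda=\sum_{j=1}^m\ell_jx^{\mathbf a_j}-\ell_0\lambda x^{\mathbf a_0}$ and $f_0=\sum_{j=1}^m\ell_jx^{\mathbf a_j}$. Let $V\subseteq\mathbb R^n$ be the real span of $A$, $V_{\mathbb Z}=V\cap\mathbb Z^n$, $\mathbb ZA$ the subgroup generated by $A$, $C(A)$ the real cone generated by $A$, $M=V_{\mathbb Z}\cap C(A)$, $P(A)=\{\sum_j c_j\mathbf a_j\mid 0\le c_j<1\}$, $\mathcal B=V_{\mathbb Z}\cap P(A)$ and $d=[V_{\mathbb Z}:\mathbb ZA]$. Let $S\subseteq\mathbb C[\lambda][x_1^{\pm1},\dots,x_n^{\pm1}]$ be the $\mathbb C[\lambda]$-algebra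 and $S_0\subseteq\mathbb C[x_1^{\pm1},\dots,x_n^{\pm1}]$ the $\mathbb C$-algebra generated by $\{x^u\mid u\in M\}$. Put $D_i=x_i\frac{\partial}{\partial x_i}+x_i\frac{\partial f_\lambda}{\partial x_i}$ on $S$, $D_{i,0}=x_i\frac{\partial}{\partial x_i}+x_i\frac{\partial f_0}{\partial x_i}$ on $S_0$, $\mathcal W=S/\sum_{i=1}^nD_iS$ and $\mathcal W_0=S_0/\sum_{i=1}^nD_{i,0}S_0$. Let $\mathcal D=\mathbb C[\lambda]\langle\partial_\lambda\rangle$ be the ring of differential operators with coefficients in $\mathbb C[\lambda]$; it acts on $\mathbb C[[\lambda]]$ in the usual way, and on $\mathcal W$ with $\partial_\lambda$ acting as $D_\lambda=\frac{\partial}{\partial\lambda}-\ell_0x^{\mathbf a_0}$. A formal series $\sum_{u\in M}A_ux^{-u}$ with coefficients in $\mathbb C$ (respectively $\mathbb C[[\lambda]]$) is regarded as a linear functional on $S_0$ (respectively $S$) through $\big\langle\sum_uA_ux^{-u},\sum_uB_ux^u\big\rangle=\sum_uB_uA_u$. Let $\gamma_-$ be the operator that keeps the terms $x^{-u}$ with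 $u\in M$ of a formal series and deletes all others. For $l\ge 0$ write $[z]_{-l}=z(z-1)\cdots(z-l+1)$ (so $[z]_0=1$). For $\mathbf b\in\mathcal B$ write $\mathbf b=\sum_{j=1}^mv_j\mathbf a_j$ with $v_j\in[0,1)$ and set $$g_{\mathbf b}=\prod_{j=1}^m\ \sum_{s\in\mathbb Z_{\le0}}[-v_j]_s\,\ell_j^{s}\,x^{(-v_j+s)\mathbf a_j},\qquad \xi_{\mathbf b}=\gamma_-\big(\exp(-\ell_0\lambda x^{\mathbf a_0})\,g_{\mathbf b}\big).$$ Then: (1) the monomials $x^{\mathbf b}$, $\mathbf b\in\mathcal B$, form a $\mathbb C$-basis of $\mathcal W_0$, and the $g_{\mathbf b}$, $\mathbf b\in\mathcal B$, induce linear functionals on $\mathcal W_0$ which form the dual basis of $\mathrm{Hom}_{\mathbb C}(\mathcal W_0,\mathbb C)$; (2) the $\xi_{\mathbf b}$, $\mathbf b\in\mathcal B$, induce $\mathcal D$-linear maps $\mathcal W\to\mathbb C[[\lambda]]$ which form a $\mathbb C$-basis of $\mathrm{Hom}_{\mathcal D}(\mathcal W,\mathbb C[[\lambda]])$; (3) in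 particular $\dim_{\mathbb C}\mathrm{Hom}_{\mathcal D}(\mathcal W,\mathbb C[[\lambda]])=|\mathcal B|=d$. -/

import Mathlib

open scoped BigOperators

noncomputable section

namespace Delsarte

/-! ### The Weyl algebra `ℂ[λ]⟨∂⟩` -/

/-- The defining relation `∂ λ = λ ∂ + 1`; the free generator `false` is `λ`, `true` is `∂`. -/
inductive WeylRel : FreeAlgebra ℂ Bool → FreeAlgebra ℂ Bool → Prop
  | comm : WeylRel (FreeAlgebra.ι ℂ true * FreeAlgebra.ι ℂ false)
      (FreeAlgebra.ι ℂ false * FreeAlgebra.ι ℂ true + 1)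

/-- The ring `ℂ[λ]⟨∂_λ⟩` of differential operators with coefficients in `ℂ[λ]`. -/
abbrev Weyl : Type := RingQuot WeylRel

/-- The generator `λ`. -/
def Weyl.lam : Weyl := RingQuot.mkAlgHom ℂ WeylRel (FreeAlgebra.ι ℂ false)

/-- The generator `∂_λ`. -/
def Weyl.del : Weyl := RingQuot.mkAlgHom ℂ WeylRel (FreeAlgebra.ι ℂ true)

/-- A pair of operators `L`, `P` with `P L = L P + 1` defines an action of the Weyl algebra,
in which `λ` acts as `L` and `∂_λ` acts as `P`. -/
def Weyl.act {F : Type*} [AddCommGroup F] [Module ℂ F] (L P : Module.End ℂ F)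
    (h : P * L = L * P + 1) : Weyl →ₐ[ℂ] Module.End ℂ F :=
  RingQuot.liftAlgHom ℂ ⟨FreeAlgebra.lift ℂ (fun t : Bool => if t then P else L), by
    rintro _ _ ⟨⟩
    simpa using h⟩

theorem Weyl.act_lam {F : Type*} [AddCommGroup F] [Module ℂ F] (L P : Module.End ℂ F)
    (h : P * L = L * P + 1) : Weyl.act L P h Weyl.lam = L := by
  simp [Weyl.act, Weyl.lam]

theorem Weyl.act_del {F : Type*} [AddCommGroup F] [Module ℂ F] (L P : Module.End ℂ F)
    (h : P * L = L * P + 1) : Weyl.act L P h Weyl.del = P := by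
  simp [Weyl.act, Weyl.del]

/-- The action of the Weyl algebra on `ℂ[[λ]]`. -/
def Weyl.actPowerSeries : Weyl →ₐ[ℂ] Module.End ℂ (PowerSeries ℂ) :=
  Weyl.act (LinearMap.mulLeft ℂ (PowerSeries.X : PowerSeries ℂ))
    (PowerSeries.derivative ℂ).toLinearMap (by
      ext1 p
      simp [PowerSeries.derivative_X])

/-- `ℂ[[λ]]` as a left module over the Weyl algebra. -/
instance : Module Weyl (PowerSeries ℂ) :=
  Module.compHom (PowerSeries ℂ) Weyl.actPowerSeries.toRingHom

theorem Weyl.smul_powerSeries (D : Weyl) (p : PowerSeries ℂ) :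
    D • p = Weyl.actPowerSeries D p := rfl

theorem Weyl.lam_smul_powerSeries (p : PowerSeries ℂ) : Weyl.lam • p = PowerSeries.X * p := by
  rw [Weyl.smul_powerSeries, Weyl.actPowerSeries, Weyl.act_lam]; rfl

theorem Weyl.del_smul_powerSeries (p : PowerSeries ℂ) :
    Weyl.del • p = PowerSeries.derivative ℂ p := by
  rw [Weyl.smul_powerSeries, Weyl.actPowerSeries, Weyl.act_del]; rfl

instance : SMulCommClass Weyl ℂ (PowerSeries ℂ) where
  smul_comm D c p := by
    simp only [Weyl.smul_powerSeries, map_smul]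

/-! ### Laurent polynomials -/

/-- Laurent polynomials in `x_1, …, x_n` over `R`. -/
abbrev Laurent (R : Type) [CommRing R] (n : ℕ) : Type := AddMonoidAlgebra R (Fin n → ℤ)

/-- The monomial `x^u`. -/
def mon (R : Type) [CommRing R] {n : ℕ} (u : Fin n → ℤ) : Laurent R n :=
  AddMonoidAlgebra.single u 1

/-- The operator `x_i ∂/∂x_i` on Laurent polynomials: `x^u ↦ u_i x^u`. -/
def theta (R : Type) [CommRing R] {n : ℕ} (i : Fin n) : Laurent R n →ₗ[R] Laurent R n where
  toFun p := AddMonoidAlgebra.ofCoeff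
    (Finsupp.onFinset p.coeff.support (fun u => (u i : R) * p.coeff u) (by
      intro u hu
      rw [Finsupp.mem_support_iff]
      exact right_ne_zero_of_mul hu))
  map_add' p q := by
    apply AddMonoidAlgebra.coeff_injective
    ext u
    simp [mul_add]
  map_smul' r p := by
    apply AddMonoidAlgebra.coeff_injective
    ext u
    simp [mul_left_comm]

theorem theta_coeff {R : Type} [CommRing R] {n : ℕ} (i : Fin n) (p : Laurent R n)
    (u : Fin n → ℤ) : (theta R i p).coeff u = (u i : R) * p.coeff u := rfl

theorem theta_single {R : Type} [CommRing R] {n : ℕ} (i : Fin n) (u : Fin n → ℤ) (r : R) :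
    theta R i (AddMonoidAlgebra.single u r) = (u i : R) • AddMonoidAlgebra.single u r := by
  apply AddMonoidAlgebra.coeff_injective
  ext v
  rw [theta_coeff, AddMonoidAlgebra.coeff_smul_apply, smul_eq_mul]
  by_cases h : u = v
  · rw [h]
  · simp [h]

theorem theta_mul {R : Type} [CommRing R] {n : ℕ} (i : Fin n) (p q : Laurent R n) :
    theta R i (p * q) = theta R i p * q + p * theta R i q := by
  induction p using AddMonoidAlgebra.induction_linear with
  | zero => simp
  | add p p' hp hp' => simp only [add_mul, map_add, hp, hp']; ring
  | single u r =>
    induction q using AddMonoidAlgebra.induction_linear with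
    | zero => simp
    | add q q' hq hq' => simp only [mul_add, map_add, hq, hq']; ring
    | single v s =>
      simp only [AddMonoidAlgebra.single_mul_single, theta_single, Pi.add_apply, Int.cast_add,
        add_smul, smul_mul_assoc, mul_smul_comm]

/-- `∂/∂λ` on Laurent polynomials over `ℂ[λ]`, acting on the coefficients. -/
def dLam {n : ℕ} : Laurent (Polynomial ℂ) n →ₗ[ℂ] Laurent (Polynomial ℂ) n where
  toFun p := AddMonoidAlgebra.map (Polynomial.derivative (R := ℂ)).toAddMonoidHom p
  map_add' p q := by
    apply AddMonoidAlgebra.coeff_injective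
    ext1 u
    simp
  map_smul' r p := by
    apply AddMonoidAlgebra.coeff_injective
    ext1 u
    simp

theorem dLam_coeff {n : ℕ} (p : Laurent (Polynomial ℂ) n) (u : Fin n → ℤ) :
    (dLam p).coeff u = Polynomial.derivative (p.coeff u) := rfl

theorem dLam_single {n : ℕ} (u : Fin n → ℤ) (r : Polynomial ℂ) :
    dLam (AddMonoidAlgebra.single u r) =
      AddMonoidAlgebra.single u (Polynomial.derivative r) := by
  apply AddMonoidAlgebra.coeff_injective
  ext1 v
  rw [dLam_coeff]
  by_cases h : u = v
  · simp [h]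
  · simp [h]

theorem dLam_smul {n : ℕ} (r : Polynomial ℂ) (p : Laurent (Polynomial ℂ) n) :
    dLam (r • p) = Polynomial.derivative r • p + r • dLam p := by
  apply AddMonoidAlgebra.coeff_injective
  ext1 v
  simp [dLam_coeff]

theorem dLam_mul {n : ℕ} (p q : Laurent (Polynomial ℂ) n) :
    dLam (p * q) = dLam p * q + p * dLam q := by
  induction p using AddMonoidAlgebra.induction_linear with
  | zero => simp
  | add p p' hp hp' => simp only [add_mul, map_add, hp, hp']; ring
  | single u r =>
    induction q using AddMonoidAlgebra.induction_linear with
    | zero => simp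
    | add q q' hq hq' => simp only [mul_add, map_add, hq, hq']; ring
    | single v s =>
      simp only [AddMonoidAlgebra.single_mul_single, dLam_single, Polynomial.derivative_mul,
        AddMonoidAlgebra.single_add]

theorem dLam_theta {n : ℕ} (i : Fin n) (p : Laurent (Polynomial ℂ) n) :
    dLam (theta (Polynomial ℂ) i p) = theta (Polynomial ℂ) i (dLam p) := by
  apply AddMonoidAlgebra.coeff_injective
  ext1 v
  simp [dLam_coeff, theta_coeff]

/-- The `R`-algebra generated by the monomials `x^u`, `u ∈ M`. -/
def monAlg (R : Type) [CommRing R] {n : ℕ} (M : AddSubmonoid (Fin n → ℤ)) :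
    Subalgebra R (Laurent R n) :=
  Algebra.adjoin R {p | ∃ u ∈ M, p = mon R u}

theorem mon_mem {R : Type} [CommRing R] {n : ℕ} {M : AddSubmonoid (Fin n → ℤ)}
    {u : Fin n → ℤ} (hu : u ∈ M) : mon R u ∈ monAlg R M :=
  Algebra.subset_adjoin ⟨u, hu, rfl⟩

theorem theta_mem {R : Type} [CommRing R] {n : ℕ} {M : AddSubmonoid (Fin n → ℤ)} (i : Fin n)
    {p : Laurent R n} (hp : p ∈ monAlg R M) : theta R i p ∈ monAlg R M := by
  induction hp using Algebra.adjoin_induction with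
  | mem p h =>
    obtain ⟨u, hu, rfl⟩ := h
    rw [mon, theta_single]
    exact (monAlg R M).smul_mem (mon_mem hu) _
  | algebraMap r =>
    rw [Algebra.algebraMap_eq_smul_one, map_smul, AddMonoidAlgebra.one_def, theta_single]
    simp
  | add p q _ _ hp hq => rw [map_add]; exact add_mem hp hq
  | mul p q hp' hq' hp hq =>
    rw [theta_mul]
    exact add_mem (mul_mem hp hq') (mul_mem hp' hq)

theorem dLam_mem {n : ℕ} {M : AddSubmonoid (Fin n → ℤ)}
    {p : Laurent (Polynomial ℂ) n} (hp : p ∈ monAlg (Polynomial ℂ) M) :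
    dLam p ∈ monAlg (Polynomial ℂ) M := by
  induction hp using Algebra.adjoin_induction with
  | mem p h =>
    obtain ⟨u, hu, rfl⟩ := h
    rw [mon, dLam_single]
    simp
  | algebraMap r =>
    rw [Algebra.algebraMap_eq_smul_one, dLam_smul, AddMonoidAlgebra.one_def, dLam_single]
    simp only [Polynomial.derivative_one, AddMonoidAlgebra.single_zero, smul_zero, add_zero]
    exact (monAlg (Polynomial ℂ) M).smul_mem (one_mem _) _
  | add p q _ _ hp hq => rw [map_add]; exact add_mem hp hq
  | mul p q hp' hq' hp hq =>
    rw [dLam_mul]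
    exact add_mem (mul_mem hp hq') (mul_mem hp' hq)

/-- The operator `x_i ∂/∂x_i + x_i ∂f/∂x_i` on the algebra generated by the `x^u`, `u ∈ M`,
for an element `f` of that algebra. -/
def twist {R : Type} [CommRing R] {n : ℕ} {M : AddSubmonoid (Fin n → ℤ)} (f : monAlg R M)
    (i : Fin n) : monAlg R M →ₗ[R] monAlg R M where
  toFun p := ⟨theta R i p + theta R i f * p,
    add_mem (theta_mem i p.2) (mul_mem (theta_mem i f.2) p.2)⟩
  map_add' p q := by
    apply Subtype.ext
    simp only [AddMemClass.coe_add, map_add]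
    ring
  map_smul' r p := by
    apply Subtype.ext
    simp

/-- The submodule `∑_i D_i S`, where `D_i = x_i ∂/∂x_i + x_i ∂f/∂x_i`. -/
def relations {R : Type} [CommRing R] {n : ℕ} {M : AddSubmonoid (Fin n → ℤ)}
    (f : monAlg R M) : Submodule R (monAlg R M) :=
  ⨆ i, LinearMap.range (twist f i)

/-! ### The combinatorial data -/

/-- The embedding `ℤⁿ → ℝⁿ`. -/
def toReal (n : ℕ) : (Fin n → ℤ) →+ (Fin n → ℝ) := (Int.castAddHom ℝ).compLeft (Fin n)

/-- Vectors `a_1, …, a_m ∈ ℤⁿ` linearly independent over `ℝ`, together with a lattice point `a_0`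
interior to their convex hull; the latter condition is expressed by the relation
`ℓ_0 a_0 = ∑ ℓ_j a_j` with positive integers `ℓ_0 = ∑ ℓ_j` of greatest common divisor one. -/
structure Datum (n m : ℕ) where
  a : Fin m → (Fin n → ℤ)
  a0 : Fin n → ℤ
  l : Fin m → ℕ
  l0 : ℕ
  linearIndependent : LinearIndependent ℝ (fun j => toReal n (a j))
  l_pos : ∀ j, 0 < l j
  l0_pos : 0 < l0
  gcd_eq_one : Nat.gcd l0 (Finset.univ.gcd l) = 1
  relation : l0 • a0 = ∑ j, l j • a j
  l0_eq : l0 = ∑ j, l j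

namespace Datum

variable {n m : ℕ} (T : Datum n m)

/-- The real span `V` of the `a_j`. -/
def V : Submodule ℝ (Fin n → ℝ) := Submodule.span ℝ (Set.range fun j => toReal n (T.a j))

/-- The lattice `V_ℤ = V ∩ ℤⁿ`. -/
def VZ : AddSubgroup (Fin n → ℤ) := T.V.toAddSubgroup.comap (toReal n)

/-- The subgroup `ℤA` generated by the `a_j`. -/
def ZA : AddSubgroup (Fin n → ℤ) := AddSubgroup.closure (Set.range T.a)

/-- The real cone `C(A)` generated by the `a_j`. -/
def cone : AddSubmonoid (Fin n → ℝ) where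
  carrier := {y | ∃ c : Fin m → ℝ, (∀ j, 0 ≤ c j) ∧ y = ∑ j, c j • toReal n (T.a j)}
  zero_mem' := ⟨0, fun _ => le_rfl, by simp⟩
  add_mem' := by
    rintro _ _ ⟨c, hc, rfl⟩ ⟨c', hc', rfl⟩
    exact ⟨c + c', fun j => add_nonneg (hc j) (hc' j), by simp [add_smul, Finset.sum_add_distrib]⟩

/-- The monoid `M = V_ℤ ∩ C(A)`. -/
def M : AddSubmonoid (Fin n → ℤ) := T.VZ.toAddSubmonoid ⊓ T.cone.comap (toReal n)

/-- The half-open parallelepiped `P(A)`. -/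
def P : Set (Fin n → ℝ) :=
  {y | ∃ c : Fin m → ℝ, (∀ j, 0 ≤ c j ∧ c j < 1) ∧ y = ∑ j, c j • toReal n (T.a j)}

/-- The set `B = V_ℤ ∩ P(A)`. -/
def B : Set (Fin n → ℤ) := {u | u ∈ T.VZ ∧ toReal n u ∈ T.P}

theorem mem_M_of_cone {u : Fin n → ℤ} (hu : toReal n u ∈ T.cone) : u ∈ T.M := by
  refine ⟨?_, hu⟩
  obtain ⟨c, -, hc⟩ := hu
  change toReal n u ∈ T.V
  rw [hc]
  exact Submodule.sum_mem _ fun j _ =>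
    Submodule.smul_mem _ _ (Submodule.subset_span (Set.mem_range_self j))

theorem a_mem (j : Fin m) : T.a j ∈ T.M :=
  T.mem_M_of_cone ⟨Pi.single j 1, fun k => by
    by_cases h : k = j
    · subst h; simp
    · simp [h], by simp [Pi.single_apply, ite_smul]⟩

theorem a0_mem : T.a0 ∈ T.M := by
  apply T.mem_M_of_cone
  refine ⟨fun j => (T.l j : ℝ) / T.l0, fun j => by positivity, ?_⟩
  have h0 : (T.l0 : ℝ) ≠ 0 := by exact_mod_cast T.l0_pos.ne'
  have h := congrArg (toReal n) T.relation
  rw [map_nsmul, map_sum] at h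
  simp only [map_nsmul, ← Nat.cast_smul_eq_nsmul ℝ] at h
  calc toReal n T.a0 = (T.l0 : ℝ)⁻¹ • ((T.l0 : ℝ) • toReal n T.a0) := by
        rw [smul_smul, inv_mul_cancel₀ h0, one_smul]
    _ = _ := by
        rw [h, Finset.smul_sum]
        refine Finset.sum_congr rfl fun j _ => ?_
        simp only [smul_smul, div_eq_inv_mul]

theorem B_subset_M {b : Fin n → ℤ} (hb : b ∈ T.B) : b ∈ T.M := by
  obtain ⟨c, hc, h⟩ := hb.2
  exact T.mem_M_of_cone ⟨c, fun j => (hc j).1, h⟩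

/-- The coordinates `v_j ∈ [0, 1)` of a point `b = ∑ v_j a_j` of `B`. -/
def coord (b : T.B) : Fin m → ℝ := Classical.choose b.2.2

theorem coord_spec (b : T.B) : (∀ j, 0 ≤ T.coord b j ∧ T.coord b j < 1) ∧
    toReal n b.1 = ∑ j, T.coord b j • toReal n (T.a j) :=
  Classical.choose_spec b.2.2

/-! ### The modules `W` and `W_0` -/

/-- The `ℂ[λ]`-algebra `S` generated by the `x^u`, `u ∈ M`. -/
abbrev S : Subalgebra (Polynomial ℂ) (Laurent (Polynomial ℂ) n) := monAlg (Polynomial ℂ) T.M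

/-- The `ℂ`-algebra `S_0` generated by the `x^u`, `u ∈ M`. -/
abbrev S0 : Subalgebra ℂ (Laurent ℂ n) := monAlg ℂ T.M

/-- The polynomial `f_λ = ∑ ℓ_j x^{a_j} - ℓ_0 λ x^{a_0}`. -/
def f : T.S :=
  ⟨∑ j, T.l j • mon (Polynomial ℂ) (T.a j)
      - T.l0 • (Polynomial.X : Polynomial ℂ) • mon (Polynomial ℂ) T.a0,
    sub_mem (sum_mem fun j _ => nsmul_mem (mon_mem (T.a_mem j)) _)
      (nsmul_mem (T.S.smul_mem (mon_mem T.a0_mem) _) _)⟩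

/-- The polynomial `f_0 = ∑ ℓ_j x^{a_j}`. -/
def f0 : T.S0 :=
  ⟨∑ j, T.l j • mon ℂ (T.a j), sum_mem fun j _ => nsmul_mem (mon_mem (T.a_mem j)) _⟩

/-- `W_0 = S_0 / ∑ D_{i,0} S_0`. -/
abbrev W0 : Type := T.S0 ⧸ relations T.f0

/-- `W = S / ∑ D_i S`. -/
abbrev W : Type := T.S ⧸ relations T.f

/-- The operator `D_λ = ∂/∂λ - ℓ_0 x^{a_0}` on `S`. -/
def DLam : T.S →ₗ[ℂ] T.S where
  toFun p := ⟨dLam p.1 - T.l0 • (mon (Polynomial ℂ) T.a0 * p.1),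
    sub_mem (dLam_mem p.2) (nsmul_mem (mul_mem (mon_mem T.a0_mem) p.2) _)⟩
  map_add' p q := by
    apply Subtype.ext
    simp only [AddMemClass.coe_add, map_add, mul_add, smul_add]
    abel
  map_smul' r p := by
    apply Subtype.ext
    change dLam (r • p.1) - T.l0 • (mon (Polynomial ℂ) T.a0 * (r • p.1)) =
      r • (dLam p.1 - T.l0 • (mon (Polynomial ℂ) T.a0 * p.1))
    rw [map_smul, mul_smul_comm, smul_sub, smul_comm r T.l0]

/-- `D_λ` commutes with the `D_i`. -/
theorem DLam_twist (i : Fin n) (p : T.S) :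
    T.DLam (twist T.f i p) = twist T.f i (T.DLam p) := by
  have hf : dLam (theta (Polynomial ℂ) i T.f.1) =
      - (T.l0 • theta (Polynomial ℂ) i (mon (Polynomial ℂ) T.a0)) := by
    rw [dLam_theta, ← map_nsmul, ← map_neg]
    congr 1
    simp only [f, map_sub, map_sum, map_nsmul, dLam_smul, mon, dLam_single]
    simp
  apply Subtype.ext
  change dLam (theta _ i p.1 + theta _ i T.f.1 * p.1) -
      T.l0 • (mon (Polynomial ℂ) T.a0 * (theta _ i p.1 + theta _ i T.f.1 * p.1)) =
    theta _ i (dLam p.1 - T.l0 • (mon (Polynomial ℂ) T.a0 * p.1)) +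
      theta _ i T.f.1 * (dLam p.1 - T.l0 • (mon (Polynomial ℂ) T.a0 * p.1))
  rw [map_add, dLam_mul, hf, dLam_theta, map_sub, map_nsmul, theta_mul]
  simp only [nsmul_eq_mul]
  ring

theorem DLam_relations :
    (relations T.f).restrictScalars ℂ ≤ ((relations T.f).restrictScalars ℂ).comap T.DLam := by
  intro p hp
  rw [Submodule.restrictScalars_mem, relations] at hp
  change T.DLam p ∈ relations T.f
  induction hp using Submodule.iSup_induction' with
  | mem i p h =>
    obtain ⟨q, rfl⟩ := h
    rw [DLam_twist]
    exact Submodule.mem_iSup_of_mem i ⟨_, rfl⟩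
  | zero => rw [map_zero]; exact zero_mem _
  | add p q _ _ hp hq => rw [map_add]; exact add_mem hp hq

/-- The operator induced by `D_λ` on `W`. -/
def DLamW : Module.End ℂ T.W :=
  Submodule.mapQ ((relations T.f).restrictScalars ℂ) ((relations T.f).restrictScalars ℂ)
    T.DLam T.DLam_relations

theorem DLamW_mk (p : T.S) :
    T.DLamW (Submodule.Quotient.mk p) = Submodule.Quotient.mk (T.DLam p) := rfl

theorem DLam_smul (r : Polynomial ℂ) (p : T.S) :
    T.DLam (r • p) = Polynomial.derivative r • p + r • T.DLam p := by
  apply Subtype.ext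
  change dLam (r • p.1) - T.l0 • (mon (Polynomial ℂ) T.a0 * (r • p.1)) =
    Polynomial.derivative r • p.1 + r • (dLam p.1 - T.l0 • (mon (Polynomial ℂ) T.a0 * p.1))
  rw [dLam_smul, mul_smul_comm, smul_sub, smul_comm r T.l0]
  abel

/-- Multiplication by `λ` on `W`. -/
def lamW : Module.End ℂ T.W :=
  (LinearMap.lsmul (Polynomial ℂ) T.W Polynomial.X).restrictScalars ℂ

theorem lamW_mk (p : T.S) : T.lamW (Submodule.Quotient.mk p) =
    Submodule.Quotient.mk ((Polynomial.X : Polynomial ℂ) • p) := rfl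

theorem DLamW_mul_lamW : T.DLamW * T.lamW = T.lamW * T.DLamW + 1 := by
  apply LinearMap.ext
  intro w
  obtain ⟨p, rfl⟩ := Submodule.Quotient.mk_surjective _ w
  rw [LinearMap.add_apply, Module.End.mul_apply, Module.End.mul_apply, Module.End.one_apply,
    lamW_mk, DLamW_mk, DLamW_mk, lamW_mk, DLam_smul, Polynomial.derivative_X, one_smul, add_comm,
    Submodule.Quotient.mk_add]

/-- The action of `ℂ[λ]⟨∂_λ⟩` on `W`, in which `∂_λ` acts as `D_λ`. -/
def actW : Weyl →ₐ[ℂ] Module.End ℂ T.W := Weyl.act T.lamW T.DLamW T.DLamW_mul_lamW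

/-- `W` as a left module over `ℂ[λ]⟨∂_λ⟩`. -/
instance : Module Weyl T.W := Module.compHom T.W T.actW.toRingHom

theorem smul_W (D : Weyl) (w : T.W) : D • w = T.actW D w := rfl

theorem lam_smul_W (w : T.W) : Weyl.lam • w = (Polynomial.X : Polynomial ℂ) • w := by
  rw [smul_W, actW, Weyl.act_lam]; rfl

theorem del_smul_W (p : T.S) :
    Weyl.del • (Submodule.Quotient.mk p : T.W) = Submodule.Quotient.mk (T.DLam p) := by
  rw [smul_W, actW, Weyl.act_del]; rfl

end Datum

/-! ### Formal series -/

/-- Formal series `∑ F_e x^e`, `e ∈ ℤⁿ`, with coefficients in `F`. -/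
abbrev Series (F : Type) (n : ℕ) : Type := (Fin n → ℤ) → F

/-- The pairing `⟨∑ A_u x^{-u}, ∑ B_u x^u⟩ = ∑ B_u A_u` of a formal series with a Laurent
polynomial. -/
def pairing {R F : Type} [CommRing R] [AddCommGroup F] [Module R F] {n : ℕ} (ξ : Series F n)
    (p : Laurent R n) : F :=
  p.coeff.sum fun u r => r • ξ (-u)

/-- The product of two formal series with coefficients in `ℂ[[λ]]`, whenever for every `k` and `e`
only finitely many terms contribute to the coefficient of `λ^k x^e`. -/
def seriesMul {n : ℕ} (F G : Series (PowerSeries ℂ) n) : Series (PowerSeries ℂ) n :=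
  fun e => PowerSeries.mk fun k => ∑ᶠ e' : Fin n → ℤ, PowerSeries.coeff k (F e' * G (e - e'))

/-- `[z]_l`, with `[z]_0 = 1`, `[z]_l = 1 / ((z+1) ⋯ (z+l))` for `l > 0`, and
`[z]_l = z (z-1) ⋯ (z+l+1)` for `l < 0`. -/
def bracket (z : ℂ) : ℤ → ℂ
  | Int.ofNat k => ∏ i ∈ Finset.range k, (z + (i + 1))⁻¹
  | Int.negSucc k => ∏ i ∈ Finset.range (k + 1), (z - i)

namespace Datum

variable {n m : ℕ} (T : Datum n m)

open scoped Classical in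
/-- The operator `γ_-`, which keeps the terms `x^{-u}` with `u ∈ M` and kills all others. -/
def gammaMinus {F : Type} [Zero F] (ξ : Series F n) : Series F n :=
  fun e => if -e ∈ T.M then ξ e else 0

open scoped Classical in
/-- The series `exp(-ℓ_0 λ x^{a_0}) = ∑_k (-ℓ_0)^k / k! λ^k x^{k a_0}`. -/
def expSeries : Series (PowerSeries ℂ) n :=
  fun e => PowerSeries.mk fun k =>
    if e = k • T.a0 then (-(T.l0 : ℂ)) ^ k / (k.factorial : ℂ) else 0

/-- The series `g_b = ∏_j ∑_{s ≤ 0} [-v_j]_s ℓ_j^s x^{(-v_j+s) a_j}`, where `b = ∑ v_j a_j`: the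
coefficient of `x^e` is the sum, over all choices of one term from each factor for which the
exponents add up to `e`, of the products of the coefficients. -/
def g (b : T.B) : Series ℂ n := fun e =>
  ∑ᶠ (s : Fin m → ℤ) (_ : (∀ j, s j ≤ 0) ∧
      toReal n e = ∑ j, (-T.coord b j + (s j : ℝ)) • toReal n (T.a j)),
    ∏ j, bracket (-(T.coord b j : ℂ)) (s j) * (T.l j : ℂ) ^ (s j)

/-- The series `ξ_b = γ_-(exp(-ℓ_0 λ x^{a_0}) g_b)`. -/
def xi (b : T.B) : Series (PowerSeries ℂ) n :=
  T.gammaMinus (seriesMul T.expSeries fun e => PowerSeries.C (T.g b e))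

end Datum

end Delsarte

end

noncomputable section

namespace Delsarte

namespace Datum

variable {n m : ℕ} (T : Datum n m)

/-! ### Coordinates with respect to `a_1, …, a_m` -/

/-! Independence of the `a_j` gives every `u` in `V_ℤ` coordinates `u_j`. Since `u = ∑ u_j a_j` and
`ℓ_0 a_0 = ∑ ℓ_j a_j`, each `D_i x^u` is the combination, with coefficients the `i`-th entries of
the `a_j`, of the elements `u_j x^u + ℓ_j (x^{u+a_j} - t x^{u+a_0})`, where `t = λ` for `W` and `t =
0` for `W_0`. A left inverse of the matrix of the `a_j` recovers these elements from the `D_i x^u`,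
so a functional descends to the quotient exactly when it kills them (`relations_le_ker_iff`).

For `t = 0` this is a two-term recurrence `ℓ_j x^{u+a_j} = -u_j x^u`. Stripping off the `a_j`
reduces every monomial to one in the half-open parallelepiped, so the `x^b` span `W_0` (`span_w0`).
The coefficients of `g_b` obey the same recurrence (`l_mul_g`), and `g_b` is `1` on `x^b` and `0` on
the other `x^{b'}`; this gives both independence and the dual basis.

For `t = λ`, compatibility with `∂_λ` says that `ψ(x^u)` has derivative `-ℓ_0 ψ(x^{u+a_0})`. Hence
all Taylor coefficients of `ψ(x^u)` are determined by the constant terms of the `ψ(x^{u+k a_0})`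
(`coeff_apply_w`). At `λ = 0` the relations of `W` become those of `W_0`, so the constant terms form
a functional on `W_0`. Conversely, every functional on `W_0` extends by the Taylor formula
(`solutionValue_relation`). The resulting isomorphism `solutionEquiv` sends `g_b` to `ξ_b`
(`xi_neg`). Finally `|B| = d` because the parallelepiped represents each class of `V_ℤ` modulo `ℤA`
once (`card_B`). -/

theorem exists_coordinates : ∃ φ : (Fin n → ℝ) →ₗ[ℝ] (Fin m → ℝ),
    ∀ c : Fin m → ℝ, φ (∑ j, c j • toReal n (T.a j)) = c := by
  obtain ⟨φ, hφ⟩ := LinearMap.exists_leftInverse_of_injective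
    (Fintype.linearCombination ℝ fun j => toReal n (T.a j))
    (LinearMap.ker_eq_bot.2
      (linearIndependent_iff_injective_fintypeLinearCombination.1 T.linearIndependent))
  exact ⟨φ, fun c => by simpa [Fintype.linearCombination_apply] using LinearMap.congr_fun hφ c⟩

/-- A linear map giving the coordinates of vectors of `V` with respect to `a_1, …, a_m`. -/
def coordinates : (Fin n → ℝ) →ₗ[ℝ] (Fin m → ℝ) := Classical.choose T.exists_coordinates

theorem coordinates_sum (c : Fin m → ℝ) :
    T.coordinates (∑ j, c j • toReal n (T.a j)) = c :=
  Classical.choose_spec T.exists_coordinates c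

/-- The coordinates of a lattice point. -/
def co : (Fin n → ℤ) →+ (Fin m → ℝ) := T.coordinates.toAddMonoidHom.comp (toReal n)

theorem co_eq_of_sum {u : Fin n → ℤ} {c : Fin m → ℝ}
    (h : toReal n u = ∑ j, c j • toReal n (T.a j)) : T.co u = c := by
  change T.coordinates (toReal n u) = c
  rw [h, coordinates_sum]

theorem toReal_injective : Function.Injective (toReal n) := fun u v h => by
  funext i
  exact Int.cast_injective (α := ℝ) (congrFun h i)

theorem toReal_eq_sum {u : Fin n → ℤ} (hu : u ∈ T.VZ) :
    toReal n u = ∑ j, T.co u j • toReal n (T.a j) := by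
  obtain ⟨c, hc⟩ := (Submodule.mem_span_range_iff_exists_fun ℝ).1 (show toReal n u ∈ T.V from hu)
  rw [T.co_eq_of_sum hc.symm, hc]

theorem co_a (j : Fin m) : T.co (T.a j) = Pi.single j 1 :=
  T.co_eq_of_sum (by simp [Pi.single_apply, ite_smul])

theorem co_a0 (j : Fin m) : T.co T.a0 j = (T.l j : ℝ) / T.l0 := by
  have h0 : (T.l0 : ℝ) ≠ 0 := by exact_mod_cast T.l0_pos.ne'
  have h := congrFun (congrArg T.co T.relation) j
  rw [map_nsmul, map_sum] at h
  simp only [map_nsmul, co_a, Finset.sum_apply, Pi.smul_apply, Pi.single_apply] at h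
  simp at h
  rw [eq_div_iff h0, mul_comm, h]

theorem M_le_VZ {u : Fin n → ℤ} (hu : u ∈ T.M) : u ∈ T.VZ := hu.1

theorem mem_M_iff {u : Fin n → ℤ} : u ∈ T.M ↔ u ∈ T.VZ ∧ ∀ j, 0 ≤ T.co u j := by
  constructor
  · rintro ⟨h, c, hc, hu⟩
    exact ⟨h, by rwa [T.co_eq_of_sum hu]⟩
  · rintro ⟨h, hc⟩
    exact ⟨h, _, hc, T.toReal_eq_sum h⟩

theorem mem_B_iff {u : Fin n → ℤ} :
    u ∈ T.B ↔ u ∈ T.VZ ∧ ∀ j, 0 ≤ T.co u j ∧ T.co u j < 1 := by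
  constructor
  · rintro ⟨h, c, hc, hu⟩
    exact ⟨h, by rwa [T.co_eq_of_sum hu]⟩
  · rintro ⟨h, hc⟩
    exact ⟨h, _, hc, T.toReal_eq_sum h⟩

theorem coord_eq (b : T.B) : T.coord b = T.co b.1 := (T.co_eq_of_sum (T.coord_spec b).2).symm

theorem eq_of_co_eq {u v : Fin n → ℤ} (hu : u ∈ T.VZ) (hv : v ∈ T.VZ) (h : T.co u = T.co v) :
    u = v :=
  toReal_injective (by rw [T.toReal_eq_sum hu, T.toReal_eq_sum hv, h])

theorem a_mem_VZ (j : Fin m) : T.a j ∈ T.VZ := T.M_le_VZ (T.a_mem j)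

theorem co_sum_zsmul (k : Fin m → ℤ) (j : Fin m) : T.co (∑ i, k i • T.a i) j = k j := by
  simp only [map_sum, map_zsmul, co_a, Finset.sum_apply, Pi.smul_apply, Pi.single_apply]
  simp

theorem sum_zsmul_mem_VZ (k : Fin m → ℤ) : ∑ i, k i • T.a i ∈ T.VZ :=
  sum_mem fun i _ => zsmul_mem (T.a_mem_VZ i) _

/-! ### Lattice points modulo `ℤA`, and induction along `M` -/

/-- The representative in the half-open parallelepiped of a lattice point modulo `ℤA`. -/
def frac (u : Fin n → ℤ) : Fin n → ℤ := u - ∑ j, ⌊T.co u j⌋ • T.a j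

theorem co_frac (u : Fin n → ℤ) (j : Fin m) : T.co (T.frac u) j = Int.fract (T.co u j) := by
  rw [frac, map_sub, Pi.sub_apply, co_sum_zsmul, Int.fract]

theorem frac_mem_B {u : Fin n → ℤ} (hu : u ∈ T.VZ) : T.frac u ∈ T.B := by
  refine T.mem_B_iff.2 ⟨sub_mem hu (T.sum_zsmul_mem_VZ _), fun j => ?_⟩
  rw [co_frac]
  exact ⟨Int.fract_nonneg _, Int.fract_lt_one _⟩

/-- Coordinates in `[0, 1)` bound the `i`-th entry of a point by `∑ j, |a_j i|`, so the points lie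
in a finite box of `ℤⁿ`. -/
theorem finite_B : T.B.Finite := by
  refine (Set.finite_Icc (fun i : Fin n => -∑ j, |T.a j i|) fun i => ∑ j, |T.a j i|).subset ?_
  intro u hu
  obtain ⟨hV, hc⟩ := T.mem_B_iff.1 hu
  have key (i : Fin n) : |u i| ≤ ∑ j, |T.a j i| := by
    have h : (u i : ℝ) = ∑ j, T.co u j * (T.a j i : ℝ) := by
      have := congrFun (T.toReal_eq_sum hV) i
      rw [Finset.sum_apply] at this
      exact this
    have : |(u i : ℝ)| ≤ ∑ j, |(T.a j i : ℝ)| := by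
      rw [h]
      refine (Finset.abs_sum_le_sum_abs _ _).trans (Finset.sum_le_sum fun j _ => ?_)
      rw [abs_mul, abs_of_nonneg (hc j).1]
      exact mul_le_of_le_one_left (abs_nonneg _) (hc j).2.le
    exact_mod_cast this
  exact ⟨fun i => (abs_le.1 (key i)).1, fun i => (abs_le.1 (key i)).2⟩

instance : Finite T.B := T.finite_B

theorem mem_ZA_iff {u : Fin n → ℤ} : u ∈ T.ZA ↔ ∃ k : Fin m → ℤ, u = ∑ j, k j • T.a j := by
  constructor
  · intro hu
    induction hu using AddSubgroup.closure_induction with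
    | mem u h =>
      obtain ⟨j, rfl⟩ := h
      exact ⟨Pi.single j 1, by simp [Pi.single_apply, ite_smul]⟩
    | zero => exact ⟨0, by simp⟩
    | add u v _ _ hu hv =>
      obtain ⟨k, rfl⟩ := hu
      obtain ⟨k', rfl⟩ := hv
      exact ⟨k + k', by simp [add_smul, Finset.sum_add_distrib]⟩
    | neg u _ hu =>
      obtain ⟨k, rfl⟩ := hu
      exact ⟨-k, by simp⟩
  · rintro ⟨k, rfl⟩
    exact sum_mem fun j _ => zsmul_mem (AddSubgroup.subset_closure (Set.mem_range_self j)) _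

/-- The coordinates of the difference are integers, and as differences of numbers in `[0, 1)` they
lie strictly between `-1` and `1`. -/
theorem eq_of_sub_mem_ZA {b b' : Fin n → ℤ} (hb : b ∈ T.B) (hb' : b' ∈ T.B)
    (h : b' - b ∈ T.ZA) : b = b' := by
  obtain ⟨k, hk⟩ := T.mem_ZA_iff.1 h
  obtain ⟨hV, hc⟩ := T.mem_B_iff.1 hb
  obtain ⟨hV', hc'⟩ := T.mem_B_iff.1 hb'
  refine T.eq_of_co_eq hV hV' (funext fun j => ?_)
  have h1 : T.co b' j - T.co b j = k j := by
    rw [← co_sum_zsmul, ← hk, map_sub, Pi.sub_apply]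
  have h2 : (k j : ℝ) < 1 := by linarith [(hc j).1, (hc' j).2]
  have h3 : (-1 : ℝ) < k j := by linarith [(hc j).2, (hc' j).1]
  have h4 : k j < 1 := by exact_mod_cast h2
  have h5 : -1 < k j := by exact_mod_cast h3
  have h6 : k j = 0 := by omega
  rw [h6, Int.cast_zero] at h1
  linarith

theorem card_B : Nat.card T.B = T.ZA.relIndex T.VZ := by
  refine Nat.card_congr (Equiv.ofBijective
    (fun b : T.B => (QuotientAddGroup.mk ⟨b.1, b.2.1⟩ : T.VZ ⧸ T.ZA.addSubgroupOf T.VZ)) ⟨?_, ?_⟩)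
  · intro b b' h
    rw [QuotientAddGroup.eq, AddSubgroup.mem_addSubgroupOf] at h
    refine Subtype.ext (T.eq_of_sub_mem_ZA b.2 b'.2 ?_)
    rw [sub_eq_neg_add]
    exact h
  · intro q
    obtain ⟨⟨u, hu⟩, rfl⟩ := QuotientAddGroup.mk_surjective q
    refine ⟨⟨T.frac u, T.frac_mem_B hu⟩, ?_⟩
    rw [QuotientAddGroup.eq, AddSubgroup.mem_addSubgroupOf]
    refine T.mem_ZA_iff.2 ⟨fun j => ⌊T.co u j⌋, ?_⟩
    change -T.frac u + u = _
    rw [frac]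
    abel

/-- Induction along `M`, starting from the points of the half-open parallelepiped. -/
theorem M_induction {p : (Fin n → ℤ) → Prop} (hB : ∀ b ∈ T.B, p b)
    (ha : ∀ u ∈ T.M, ∀ j, p u → p (u + T.a j)) {u : Fin n → ℤ} (hu : u ∈ T.M) : p u := by
  -- The induction runs on the sum of the integer parts of the coordinates, which vanishes exactly
  -- on the parallelepiped and drops by one when some `a_j` is subtracted.
  obtain ⟨N, hN⟩ : ∃ N : ℕ, ∑ j, ⌊T.co u j⌋ = N :=
    Int.eq_ofNat_of_zero_le
      (Finset.sum_nonneg fun j _ => Int.floor_nonneg.2 ((T.mem_M_iff.1 hu).2 j))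
  induction N generalizing u with
  | zero =>
    refine hB u (T.mem_B_iff.2 ⟨hu.1, fun j => ⟨(T.mem_M_iff.1 hu).2 j, ?_⟩⟩)
    have := (Finset.sum_eq_zero_iff_of_nonneg
      (fun j _ => Int.floor_nonneg.2 ((T.mem_M_iff.1 hu).2 j))).1 hN j (Finset.mem_univ j)
    exact (Int.floor_eq_zero_iff.1 this).2
  | succ N ih =>
    obtain ⟨j, -, hj⟩ : ∃ j ∈ Finset.univ, 0 < ⌊T.co u j⌋ :=
      Finset.exists_lt_of_sum_lt (by
        rw [hN, Finset.sum_const_zero]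
        positivity)
    -- The shift is written as the cast of an integer so that it can be pulled out of the floor.
    have hco (i : Fin m) : T.co (u - T.a j) i = T.co u i - ((Pi.single j 1 : Fin m → ℤ) i : ℝ) := by
      rw [map_sub, co_a, Pi.sub_apply]
      by_cases h : i = j
      · subst h; simp
      · simp [h]
    have h : u - T.a j ∈ T.M := by
      refine T.mem_M_iff.2 ⟨sub_mem hu.1 (T.a_mem_VZ j), fun i => ?_⟩
      rw [hco]
      by_cases h : i = j
      · subst h
        rw [Pi.single_eq_same, Int.cast_one, sub_nonneg]
        simpa using Int.le_floor.1 (Int.add_one_le_iff.2 hj)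
      · simpa [h] using (T.mem_M_iff.1 hu).2 i
    have := ha _ h j (ih h (by
      simp only [hco, Int.floor_sub_intCast, Finset.sum_sub_distrib, hN]
      simp))
    rwa [sub_add_cancel] at this

end Datum

/-! ### The algebra of monomials and functionals given by formal series -/

section monAlg

variable {R : Type} [CommRing R] {n : ℕ} {M : AddSubmonoid (Fin n → ℤ)}

/-- The monomial `x^u` as an element of the algebra generated by the `x^u`, `u ∈ M`. -/
def monM (R : Type) [CommRing R] {n : ℕ} {M : AddSubmonoid (Fin n → ℤ)} (u : M) : monAlg R M :=
  ⟨mon R u.1, mon_mem u.2⟩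

/-- The monomials `x^u`, `u ∈ M`, are closed under multiplication, so the algebra they generate is
already their linear span. -/
theorem span_monM : Submodule.span R (Set.range (monM R : M → monAlg R M)) = ⊤ := by
  have h : (monAlg R M).toSubmodule = Submodule.span R {p | ∃ u ∈ M, p = mon R u} := by
    refine Algebra.adjoin_eq_span_of_subset R ?_
    refine le_trans ?_ Submodule.subset_span
    refine (Submonoid.closure_le (S := {
      carrier := {p : Laurent R n | ∃ u ∈ M, p = mon R u}
      one_mem' := ⟨0, zero_mem _, rfl⟩
      mul_mem' := ?_ })).2 le_rfl
    rintro _ _ ⟨u, hu, rfl⟩ ⟨v, hv, rfl⟩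
    exact ⟨u + v, add_mem hu hv, by simp [mon, AddMonoidAlgebra.single_mul_single]⟩
  refine Submodule.map_injective_of_injective (f := (monAlg R M).toSubmodule.subtype)
    Subtype.val_injective ?_
  rw [Submodule.map_subtype_top, Submodule.map_span]
  refine Eq.trans ?_ h.symm
  congr 1
  ext p
  constructor
  · rintro ⟨_, ⟨u, rfl⟩, rfl⟩
    exact ⟨u.1, u.2, rfl⟩
  · rintro ⟨u, hu, rfl⟩
    exact ⟨_, ⟨⟨u, hu⟩, rfl⟩, rfl⟩

theorem monAlg_hom_ext {F : Type*} [AddCommGroup F] [Module R F] {L L' : monAlg R M →ₗ[R] F}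
    (h : ∀ u, L (monM R u) = L' (monM R u)) : L = L' :=
  LinearMap.ext_on_range span_monM h

variable {F : Type} [AddCommGroup F] [Module R F]

/-- The pairing with a formal series as a linear map. -/
def functional (M : AddSubmonoid (Fin n → ℤ)) (ξ : Series F n) : monAlg R M →ₗ[R] F where
  toFun p := pairing ξ p.1
  map_add' p q := by
    simp only [pairing, AddMemClass.coe_add, AddMonoidAlgebra.coeff_add]
    exact Finsupp.sum_add_index' (by simp) (by simp [add_smul])
  map_smul' r p := by
    simp only [pairing, SetLike.val_smul, AddMonoidAlgebra.coeff_smul, RingHom.id_apply,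
      Finsupp.smul_sum]
    rw [Finsupp.sum_smul_index (by simp)]
    simp only [mul_smul]

theorem functional_apply (ξ : Series F n) (p : monAlg R M) :
    functional M ξ p = pairing ξ p.1 := rfl

theorem functional_monM (ξ : Series F n) (u : M) : functional M ξ (monM R u) = ξ (-u.1) := by
  simp [functional_apply, pairing, monM, mon]

open scoped Classical in
/-- The series with prescribed coefficients at the `x^{-u}`, `u ∈ M`, and no other terms. -/
def seriesOf (G : M → F) : Series F n := fun e => if h : -e ∈ M then G ⟨-e, h⟩ else 0

theorem functional_seriesOf (G : M → F) (u : M) :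
    functional M (seriesOf G) (monM R u) = G u := by
  rw [functional_monM, seriesOf, dif_pos (by simp)]
  simp

end monAlg

/-! ### The relations in terms of the coordinates `u_j` -/

namespace Datum

variable {n m : ℕ} (T : Datum n m)

/-- The exponent `a_j` as an element of `M`. -/
def aM (j : Fin m) : T.M := ⟨T.a j, T.a_mem j⟩

/-- The exponent `a_0` as an element of `M`. -/
def a0M : T.M := ⟨T.a0, T.a0_mem⟩

variable {R : Type} [CommRing R]

theorem l0_mul_cast (i : Fin n) :
    (T.l0 : R) * ((T.a0 i : ℤ) : R) = ∑ j, ((T.a j i : ℤ) : R) * (T.l j : R) := by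
  have h := congrFun T.relation i
  rw [Finset.sum_apply] at h
  have h2 := congrArg (Int.cast : ℤ → R) h
  simp only [Pi.smul_apply, nsmul_eq_mul, Int.cast_mul, Int.cast_natCast, Int.cast_sum] at h2
  rw [h2]
  exact Finset.sum_congr rfl fun j _ => mul_comm _ _

variable [Algebra ℂ R]

/-- The relation `u_j x^u + ℓ_j (x^{u + a_j} - t x^{u + a_0})`, where `u = ∑ u_j a_j`. -/
def relator (t : R) (j : Fin m) (u : T.M) : monAlg R T.M :=
  algebraMap ℂ R (T.co u.1 j : ℂ) • monM R u +
    (T.l j : R) • (monM R (u + T.aM j) - t • monM R (u + T.a0M))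

theorem cast_eq_sum (u : T.M) (i : Fin n) :
    ((u.1 i : ℤ) : R) = ∑ j, ((T.a j i : ℤ) : R) * algebraMap ℂ R (T.co u.1 j : ℂ) := by
  have h : (u.1 i : ℝ) = ∑ j, T.co u.1 j * (T.a j i : ℝ) := by
    have := congrFun (T.toReal_eq_sum u.2.1) i
    rw [Finset.sum_apply] at this
    exact this
  have h2 := congrArg (fun r : ℝ => algebraMap ℂ R (r : ℂ)) h
  simp only [Complex.ofReal_intCast, map_intCast, Complex.ofReal_sum, Complex.ofReal_mul, map_sum,
    map_mul] at h2
  rw [h2]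
  exact Finset.sum_congr rfl fun j _ => mul_comm _ _

/-- All three kinds of coefficients in `D_i x^u` are expanded in the `i`-th entries of the `a_j`:
`u_i` by `cast_eq_sum`, the entry `ℓ_0 a_{0,i}` by `l0_mul_cast`, and the terms of `x^{a_j}` as they
stand. Keeping `t` free treats `f_λ` and `f_0` together. -/
theorem twist_monM {t : R} {p : monAlg R T.M}
    (hp : p.1 = ∑ j, T.l j • mon R (T.a j) - T.l0 • t • mon R T.a0) (i : Fin n) (u : T.M) :
    twist p i (monM R u) = ∑ j, ((T.a j i : ℤ) : R) • T.relator t j u := by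
  apply Subtype.ext
  have hmul (v w : Fin n → ℤ) : mon R v * mon R w = mon R (w + v) := by
    simp [mon, AddMonoidAlgebra.single_mul_single, add_comm]
  have hL : (twist p i (monM R u)).1 = ((u.1 i : ℤ) : R) • mon R u.1 +
      (∑ j, (((T.a j i : ℤ) : R) * (T.l j : R)) • mon R (u.1 + T.a j) -
        (t * ((T.l0 : R) * ((T.a0 i : ℤ) : R))) • mon R (u.1 + T.a0)) := by
    change theta R i (mon R u.1) + theta R i p.1 * mon R u.1 = _
    have ht (v : Fin n → ℤ) : theta R i (mon R v) = ((v i : ℤ) : R) • mon R v := theta_single _ _ _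
    rw [hp]
    simp only [map_sub, map_sum, map_smul, ht, sub_mul, Finset.sum_mul, smul_mul_assoc,
      hmul, ← Nat.cast_smul_eq_nsmul R, smul_smul]
    congr 3
    · funext j
      rw [mul_comm]
    · ring
  have hR : (∑ j, ((T.a j i : ℤ) : R) • T.relator t j u).1 =
      ∑ j, ((T.a j i : ℤ) : R) • (algebraMap ℂ R (T.co u.1 j : ℂ) • mon R u.1 +
        (T.l j : R) • (mon R (u.1 + T.a j) - t • mon R (u.1 + T.a0))) := by
    rw [AddSubmonoidClass.coe_finsetSum]
    rfl
  rw [hL, hR, cast_eq_sum, l0_mul_cast]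
  simp only [smul_add, smul_sub, smul_smul, Finset.sum_add_distrib, Finset.sum_sub_distrib,
    Finset.sum_smul, Finset.mul_sum]
  congr 3
  funext j
  congr 1
  ring

/-- The matrix of `coordinates` is a left inverse of the matrix with columns `a_j`, and so inverts
the formula of `twist_monM`. -/
theorem relator_eq_sum_twist {t : R} {p : monAlg R T.M}
    (hp : p.1 = ∑ j, T.l j • mon R (T.a j) - T.l0 • t • mon R T.a0) (j : Fin m) (u : T.M) :
    T.relator t j u = ∑ i, algebraMap ℂ R (T.coordinates (Pi.single i 1) j : ℂ) •
      twist p i (monM R u) := by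
  simp only [T.twist_monM hp, Finset.smul_sum, smul_smul]
  rw [Finset.sum_comm]
  simp only [← Finset.sum_smul]
  have h (k : Fin m) : ∑ i, algebraMap ℂ R (T.coordinates (Pi.single i 1) j : ℂ) *
      ((T.a k i : ℤ) : R) = if j = k then 1 else 0 := by
    have h1 : ∑ i, T.coordinates (Pi.single i 1) j * (T.a k i : ℝ) = if j = k then 1 else 0 := by
      have h2 := congrFun (T.co_a k) j
      change T.coordinates (toReal n (T.a k)) j = _ at h2
      rw [Pi.single_apply, LinearMap.pi_apply_eq_sum_univ, Finset.sum_apply] at h2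
      rw [← h2]
      refine Finset.sum_congr rfl fun i _ => ?_
      rw [Pi.smul_apply, smul_eq_mul, mul_comm]
      have he : (Pi.single i 1 : Fin n → ℝ) = fun k => if i = k then 1 else 0 := by
        funext k
        simp [Pi.single_apply, eq_comm]
      rw [he]
      rfl
    have h3 := congrArg (fun r : ℝ => algebraMap ℂ R (r : ℂ)) h1
    simp only [Complex.ofReal_sum, Complex.ofReal_mul, Complex.ofReal_intCast, map_sum, map_mul,
      map_intCast] at h3
    rw [h3]
    split_ifs <;> simp
  simp only [h]
  simp

/-- The `D_i x^u` and the relators are combinations of each other with scalar coefficients, for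
fixed `u`. This replaces `n` differential conditions by one recurrence for each `a_j`. -/
theorem relations_le_ker_iff {t : R} {p : monAlg R T.M}
    (hp : p.1 = ∑ j, T.l j • mon R (T.a j) - T.l0 • t • mon R T.a0)
    {F : Type*} [AddCommGroup F] [Module R F] (L : monAlg R T.M →ₗ[R] F) :
    relations p ≤ LinearMap.ker L ↔ ∀ j u, L (T.relator t j u) = 0 := by
  constructor
  · intro h j u
    rw [T.relator_eq_sum_twist hp, map_sum]
    refine Finset.sum_eq_zero fun i _ => ?_
    rw [map_smul, show L (twist p i (monM R u)) = 0 from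
      h (Submodule.mem_iSup_of_mem i ⟨_, rfl⟩), smul_zero]
  · intro h
    refine iSup_le fun i => ?_
    rw [LinearMap.range_le_ker_iff]
    refine monAlg_hom_ext fun u => ?_
    rw [LinearMap.comp_apply, T.twist_monM hp, map_sum, LinearMap.zero_apply]
    exact Finset.sum_eq_zero fun j _ => by rw [map_smul, h, smul_zero]

theorem f_eq : (T.f : Laurent (Polynomial ℂ) n) = ∑ j, T.l j • mon (Polynomial ℂ) (T.a j)
    - T.l0 • (Polynomial.X : Polynomial ℂ) • mon (Polynomial ℂ) T.a0 := rfl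

/-- Puts `f_0` in the common shape, with `t = 0`. -/
theorem f0_eq : (T.f0 : Laurent ℂ n) = ∑ j, T.l j • mon ℂ (T.a j)
    - T.l0 • (0 : ℂ) • mon ℂ T.a0 := by
  rw [zero_smul, smul_zero, sub_zero]
  rfl

end Datum

/-! ### The coefficients of the series `g_b` -/

theorem bracket_zero (z : ℂ) : bracket z 0 = 1 := by
  change ∏ i ∈ Finset.range 0, (z + (i + 1))⁻¹ = 1
  simp

theorem bracket_neg_natCast (z : ℂ) (k : ℕ) :
    bracket z (-(k : ℤ)) = ∏ i ∈ Finset.range k, (z - i) := by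
  cases k with
  | zero => simp [bracket_zero]
  | succ k => rfl

theorem bracket_neg_add_one (z : ℂ) {k : ℤ} (hk : 0 ≤ k) :
    bracket z (-(k + 1)) = bracket z (-k) * (z - k) := by
  lift k to ℕ using hk
  rw [show (k : ℤ) + 1 = ((k + 1 : ℕ) : ℤ) by push_cast; ring, bracket_neg_natCast,
    bracket_neg_natCast, Finset.prod_range_succ, Int.cast_natCast]

namespace Datum

variable {n m : ℕ} (T : Datum n m)

theorem l_ne_zero (j : Fin m) : (T.l j : ℂ) ≠ 0 := by exact_mod_cast (T.l_pos j).ne'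

theorem l0_ne_zero : (T.l0 : ℂ) ≠ 0 := by exact_mod_cast T.l0_pos.ne'

theorem co_nonneg (u : T.M) (j : Fin m) : 0 ≤ T.co u.1 j := (T.mem_M_iff.1 u.2).2 j

/-- The exponents contributing to the coefficient of `x^{-u}` in `g_b`. -/
theorem exponent_iff (b : T.B) (u : T.M) (s : Fin m → ℤ) :
    ((∀ j, s j ≤ 0) ∧
      toReal n (-u.1) = ∑ j, (-T.co b.1 j + (s j : ℝ)) • toReal n (T.a j)) ↔
    s = (fun j => -⌊T.co u.1 j⌋) ∧ T.frac u.1 = b.1 := by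
  have hb := (T.mem_B_iff.1 b.2).2
  constructor
  · rintro ⟨hs, h⟩
    have h1 (j : Fin m) : T.co u.1 j = T.co b.1 j + ((-s j : ℤ) : ℝ) := by
      have := congrFun (T.co_eq_of_sum h) j
      rw [map_neg, Pi.neg_apply] at this
      push_cast
      linarith
    refine ⟨funext fun j => ?_, T.eq_of_co_eq (T.frac_mem_B u.2.1).1 b.2.1 (funext fun j => ?_)⟩
    · rw [h1, Int.floor_add_intCast, Int.floor_eq_zero_iff.2 (hb j)]
      ring
    · rw [co_frac, h1, Int.fract_add_intCast, Int.fract_eq_self.2 (hb j)]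
  · rintro ⟨rfl, h⟩
    refine ⟨fun j => neg_nonpos.2 (Int.floor_nonneg.2 (T.co_nonneg u j)), ?_⟩
    rw [map_neg, T.toReal_eq_sum u.2.1, ← Finset.sum_neg_distrib]
    refine Finset.sum_congr rfl fun j _ => ?_
    rw [← h, co_frac, ← neg_smul]
    congr 1
    push_cast
    linarith [Int.fract_add_floor (T.co u.1 j)]

open scoped Classical in
-- Independence of the `a_j` leaves at most one choice of exponents: `s_j` must be minus the integer
-- part of `u_j`, and `b` must be the fractional part of `u`. The sum therefore has at most one
-- term.
theorem g_neg (b : T.B) (u : T.M) :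
    T.g b (-u.1) = if T.frac u.1 = b.1 then
      ∏ j, bracket (-(T.co b.1 j : ℂ)) (-⌊T.co u.1 j⌋) * (T.l j : ℂ) ^ (-⌊T.co u.1 j⌋)
    else 0 := by
  simp only [g, coord_eq, exponent_iff]
  split_ifs with h
  · simp only [h, and_true]
    rw [finsum_eq_single _ (fun j => -⌊T.co u.1 j⌋) fun s hs => by simp [hs]]
    simp
  · simp [h]

theorem frac_add_a (u : Fin n → ℤ) (j : Fin m) : T.frac (u + T.a j) = T.frac u := by
  have h (i : Fin m) : ⌊T.co (u + T.a j) i⌋ = ⌊T.co u i⌋ + (Pi.single j 1 : Fin m → ℤ) i := by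
    rw [map_add, co_a, Pi.add_apply]
    by_cases hi : i = j
    · subst hi; simp
    · simp [hi]
  simp only [frac, h, add_smul, Finset.sum_add_distrib, Pi.single_apply, ite_smul, one_smul,
    zero_smul]
  simp

/-- Adding `a_j` keeps the fractional part and raises only the `j`-th floor `k` by one. The `j`-th
factor is thereby multiplied by `(-v_j - k) / ℓ_j`, and `v_j + k = u_j`. This is the recurrence that
lets `g_b` descend to `W_0`. -/
theorem l_mul_g (b : T.B) (u : T.M) (j : Fin m) :
    (T.l j : ℂ) * T.g b (-(u + T.aM j).1) = -(T.co u.1 j : ℂ) * T.g b (-u.1) := by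
  rw [g_neg, g_neg, show (u + T.aM j).1 = u.1 + T.a j from rfl, frac_add_a]
  split_ifs with h
  · have hj : ⌊T.co (u.1 + T.a j) j⌋ = ⌊T.co u.1 j⌋ + 1 := by
      rw [map_add, co_a, Pi.add_apply, Pi.single_eq_same, Int.floor_add_one]
    have hi (i : Fin m) (hi : i ≠ j) : ⌊T.co (u.1 + T.a j) i⌋ = ⌊T.co u.1 i⌋ := by
      rw [map_add, co_a, Pi.add_apply, Pi.single_eq_of_ne hi, add_zero]
    rw [← Finset.mul_prod_erase _ _ (Finset.mem_univ j),
      ← Finset.mul_prod_erase Finset.univ (fun i => bracket (-(T.co b.1 i : ℂ)) (-⌊T.co u.1 i⌋) *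
        (T.l i : ℂ) ^ (-⌊T.co u.1 i⌋)) (Finset.mem_univ j),
      Finset.prod_congr rfl fun i h => by rw [hi i (Finset.ne_of_mem_erase h)], hj,
      bracket_neg_add_one _ (Int.floor_nonneg.2 (T.co_nonneg u j)), neg_add,
      zpow_add₀ (T.l_ne_zero j), zpow_neg_one]
    have hco : -(T.co b.1 j : ℂ) - (⌊T.co u.1 j⌋ : ℂ) = -(T.co u.1 j : ℂ) := by
      rw [← h, co_frac, Int.fract]
      push_cast
      ring
    rw [hco]
    field_simp [T.l_ne_zero j]
  · simp

theorem frac_of_mem_B {b : Fin n → ℤ} (hb : b ∈ T.B) : T.frac b = b := by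
  have h (j : Fin m) : ⌊T.co b j⌋ = 0 := Int.floor_eq_zero_iff.2 ((T.mem_B_iff.1 hb).2 j)
  simp [frac, h]

/-- A point of the half-open parallelepiped as an element of `M`. -/
def bM (b : T.B) : T.M := ⟨b.1, T.B_subset_M b.2⟩

theorem g_neg_self (b : T.B) : T.g b (-b.1) = 1 := by
  have h (j : Fin m) : ⌊T.co b.1 j⌋ = 0 := Int.floor_eq_zero_iff.2 ((T.mem_B_iff.1 b.2).2 j)
  rw [show b.1 = (T.bM b).1 from rfl, g_neg]
  simp [bM, T.frac_of_mem_B b.2, h, bracket_zero]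

theorem g_neg_of_ne {b b' : T.B} (h : b ≠ b') : T.g b (-b'.1) = 0 := by
  rw [show b'.1 = (T.bM b').1 from rfl, g_neg, if_neg]
  rw [show (T.bM b').1 = b'.1 from rfl, T.frac_of_mem_B b'.2]
  exact fun h' => h (Subtype.ext h'.symm)

/-! ### The module `W_0` -/

/-- The class of `x^u` in `W_0`. -/
def w0 (u : T.M) : T.W0 := Submodule.Quotient.mk (monM ℂ u)

theorem relations_f0_le_ker_iff (L : T.S0 →ₗ[ℂ] ℂ) :
    relations T.f0 ≤ LinearMap.ker L ↔ ∀ j u,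
      (T.l j : ℂ) * L (monM ℂ (u + T.aM j)) = -(T.co u.1 j : ℂ) * L (monM ℂ u) := by
  rw [T.relations_le_ker_iff T.f0_eq]
  refine forall₂_congr fun j u => ?_
  simp only [relator, Algebra.algebraMap_self, RingHom.id_apply, zero_smul, sub_zero, map_add,
    map_smul, smul_eq_mul]
  rw [neg_mul, eq_neg_iff_add_eq_zero, add_comm]

theorem w0_add_a (u : T.M) (j : Fin m) :
    T.w0 (u + T.aM j) = (-(T.co u.1 j : ℂ) / (T.l j : ℂ)) • T.w0 u := by
  have h := (T.relations_le_ker_iff T.f0_eq (relations T.f0).mkQ).1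
    (by rw [Submodule.ker_mkQ]) j u
  simp only [relator, Algebra.algebraMap_self, RingHom.id_apply, zero_smul, sub_zero, map_add,
    map_smul, Submodule.mkQ_apply] at h
  change (T.co u.1 j : ℂ) • T.w0 u + (T.l j : ℂ) • T.w0 (u + T.aM j) = 0 at h
  rw [div_eq_inv_mul, mul_smul, eq_inv_smul_iff₀ (T.l_ne_zero j), neg_smul,
    eq_neg_iff_add_eq_zero, add_comm, h]

theorem W0_hom_ext {F : Type*} [AddCommGroup F] [Module ℂ F] {L L' : T.W0 →ₗ[ℂ] F}
    (h : ∀ u, L (T.w0 u) = L' (T.w0 u)) : L = L' :=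
  Submodule.linearMap_qext _ (monAlg_hom_ext h)

/-- The functional on `W_0` induced by `g_b`. -/
def gammaW0 (b : T.B) : T.W0 →ₗ[ℂ] ℂ :=
  (relations T.f0).liftQ (functional T.M (T.g b)) <| (T.relations_f0_le_ker_iff _).2 fun j u => by
    rw [functional_monM, functional_monM, l_mul_g]

theorem gammaW0_w0 (b : T.B) (u : T.M) : T.gammaW0 b (T.w0 u) = T.g b (-u.1) :=
  functional_monM _ _

/-- By `w0_add_a` the class of `x^{u+a_j}` is a multiple of that of `x^u`, so `M_induction` brings
every monomial down to some `x^b`. -/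
theorem span_w0 : ⊤ ≤ Submodule.span ℂ (Set.range fun b : T.B => T.w0 (T.bM b)) := by
  have key : ∀ u ∈ T.M, ∀ hu : u ∈ T.M,
      T.w0 ⟨u, hu⟩ ∈ Submodule.span ℂ (Set.range fun b : T.B => T.w0 (T.bM b)) := by
    intro u hu
    refine T.M_induction (p := fun u => ∀ hu : u ∈ T.M,
      T.w0 ⟨u, hu⟩ ∈ Submodule.span ℂ (Set.range fun b : T.B => T.w0 (T.bM b)))
      (fun b hb _ => Submodule.subset_span ⟨⟨b, hb⟩, rfl⟩) ?_ hu
    intro u hu j ih _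
    rw [show T.w0 ⟨u + T.a j, _⟩ = T.w0 (⟨u, hu⟩ + T.aM j) from rfl, w0_add_a]
    exact Submodule.smul_mem _ _ (ih hu)
  have h : Submodule.span ℂ (Set.range T.w0) = ⊤ := by
    rw [show T.w0 = (relations T.f0).mkQ ∘ monM ℂ from rfl, Set.range_comp, ← Submodule.map_span,
      span_monM, Submodule.map_top, Submodule.range_mkQ]
  rw [← h, Submodule.span_le]
  rintro _ ⟨u, rfl⟩
  exact key u.1 u.2 u.2

/-- The basis of `W_0` formed by the `x^b`. -/
def basisW0 : Module.Basis T.B ℂ T.W0 :=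
  -- Independence comes from the functionals `g_b`, which are biorthogonal to the `x^b`.
  Module.Basis.mk (LinearIndependent.of_pairwise_dual_eq_zero_one
    (fun b => T.w0 (T.bM b)) T.gammaW0
    (fun b _ h => (T.gammaW0_w0 b _).trans (T.g_neg_of_ne h))
    (fun b => (T.gammaW0_w0 b _).trans (T.g_neg_self b))) T.span_w0

theorem basisW0_apply (b : T.B) : T.basisW0 b = T.w0 (T.bM b) := Module.Basis.mk_apply _ _ _

open scoped Classical in
/-- The basis of the dual of `W_0` formed by the `g_b`. -/
def dualBasisW0 : Module.Basis T.B ℂ (T.W0 →ₗ[ℂ] ℂ) := T.basisW0.dualBasis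

theorem dualBasisW0_apply (b : T.B) : T.dualBasisW0 b = T.gammaW0 b := by
  classical
  refine T.basisW0.ext fun b' => ?_
  rw [dualBasisW0, Module.Basis.dualBasis_apply_self, basisW0_apply, gammaW0_w0]
  split_ifs with h
  · rw [h]
    exact (T.g_neg_self b).symm
  · exact (T.g_neg_of_ne (Ne.symm h)).symm

end Datum

/-! ### Linearity over `ℂ[λ]` and over the Weyl algebra -/

theorem Weyl.induction {p : Weyl → Prop} (lam : p Weyl.lam) (del : p Weyl.del)
    (scalar : ∀ c : ℂ, p (algebraMap ℂ Weyl c)) (add : ∀ D E, p D → p E → p (D + E))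
    (mul : ∀ D E, p D → p E → p (D * E)) (D : Weyl) : p D := by
  obtain ⟨D, rfl⟩ := RingQuot.mkAlgHom_surjective ℂ WeylRel D
  induction D using FreeAlgebra.induction with
  | grade0 c => rw [AlgHom.commutes]; exact scalar c
  | grade1 t => cases t; exacts [lam, del]
  | mul D E hD hE => rw [map_mul]; exact mul _ _ hD hE
  | add D E hD hE => rw [map_add]; exact add _ _ hD hE

theorem Weyl.algebraMap_smul_powerSeries (c : ℂ) (p : PowerSeries ℂ) :
    algebraMap ℂ Weyl c • p = c • p := by
  rw [Weyl.smul_powerSeries, AlgHom.commutes, Module.algebraMap_end_apply]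

theorem polynomial_smul_powerSeries (r : Polynomial ℂ) (p : PowerSeries ℂ) :
    r • p = (r : PowerSeries ℂ) * p := rfl

theorem C_smul_powerSeries (c : ℂ) (p : PowerSeries ℂ) :
    (Polynomial.C c : Polynomial ℂ) • p = c • p := by
  rw [polynomial_smul_powerSeries, Polynomial.coe_C, PowerSeries.smul_eq_C_mul]

theorem X_smul_powerSeries (p : PowerSeries ℂ) :
    (Polynomial.X : Polynomial ℂ) • p = PowerSeries.X * p := by
  rw [polynomial_smul_powerSeries, Polynomial.coe_X]

theorem derivative_polynomial_smul (r : Polynomial ℂ) (p : PowerSeries ℂ) :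
    PowerSeries.derivative ℂ (r • p) =
      Polynomial.derivative r • p + r • PowerSeries.derivative ℂ p := by
  simp only [polynomial_smul_powerSeries, Derivation.leibniz, PowerSeries.derivative_coe,
    smul_eq_mul]
  ring

namespace Datum

variable {n m : ℕ} (T : Datum n m)

theorem algebraMap_smul_W (c : ℂ) (w : T.W) :
    algebraMap ℂ Weyl c • w = (Polynomial.C c : Polynomial ℂ) • w := by
  rw [smul_W, AlgHom.commutes, Module.algebraMap_end_apply]
  obtain ⟨p, rfl⟩ := Submodule.Quotient.mk_surjective _ w
  rw [← Submodule.Quotient.mk_smul, ← Submodule.Quotient.mk_smul]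
  congr 1
  exact (algebraMap_smul (Polynomial ℂ) c p).symm

variable {T} in
/-- Linear maps over the Weyl algebra are linear over `ℂ[λ]`. -/
def polyLinear (ψ : T.W →ₗ[Weyl] PowerSeries ℂ) : T.W →ₗ[Polynomial ℂ] PowerSeries ℂ where
  toFun := ψ
  map_add' := map_add ψ
  map_smul' r w := by
    have hC (c : ℂ) (w : T.W) :
        ψ ((Polynomial.C c : Polynomial ℂ) • w) = (Polynomial.C c : Polynomial ℂ) • ψ w := by
      rw [← algebraMap_smul_W, map_smul, Weyl.algebraMap_smul_powerSeries, C_smul_powerSeries]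
    have hX (w : T.W) :
        ψ ((Polynomial.X : Polynomial ℂ) • w) = (Polynomial.X : Polynomial ℂ) • ψ w := by
      rw [← lam_smul_W, map_smul, Weyl.lam_smul_powerSeries, X_smul_powerSeries]
    rw [RingHom.id_apply]
    induction r using Polynomial.induction_on generalizing w with
    | C c => exact hC c w
    | add r s hr hs => rw [add_smul, add_smul, map_add, hr, hs]
    | monomial k c ih => rw [pow_succ, ← mul_assoc, mul_smul, ih, hX, ← mul_smul]

/-- The class of `x^u` in `W`. -/
def w (u : T.M) : T.W := Submodule.Quotient.mk (monM (Polynomial ℂ) u)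

/-- A map linear over the Weyl algebra is linear over `ℂ[λ]`, and the `x^u` generate `S` over
`ℂ[λ]`. -/
theorem solution_ext {ψ ψ' : T.W →ₗ[Weyl] PowerSeries ℂ} (h : ∀ u, ψ (T.w u) = ψ' (T.w u)) :
    ψ = ψ' := by
  have : polyLinear ψ = polyLinear ψ' := Submodule.linearMap_qext _ (monAlg_hom_ext h)
  exact LinearMap.ext fun w => LinearMap.congr_fun this w

theorem DLam_monM (u : T.M) : T.DLam (monM (Polynomial ℂ) u) =
    -(T.l0 • monM (Polynomial ℂ) (u + T.a0M)) := by
  apply Subtype.ext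
  change dLam (mon _ u.1) - T.l0 • (mon _ T.a0 * mon _ u.1) = -(T.l0 • mon _ (u.1 + T.a0))
  rw [mon, mon, dLam_single, AddMonoidAlgebra.single_mul_single, Polynomial.derivative_one,
    AddMonoidAlgebra.single_zero, zero_sub, mul_one, add_comm]
  rfl

/-- A `ℂ[λ]`-linear map compatible with the derivations on the `x^u` is linear over the Weyl
algebra. -/
def weylLinear (Φ : T.W →ₗ[Polynomial ℂ] PowerSeries ℂ)
    (h : ∀ u, PowerSeries.derivative ℂ (Φ (T.w u)) = -(T.l0 • Φ (T.w (u + T.a0M)))) :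
    T.W →ₗ[Weyl] PowerSeries ℂ where
  toFun := Φ
  map_add' := map_add Φ
  map_smul' D w := by
    -- Compatibility passes from the monomials to their `ℂ[λ]`-span because `D_λ` and the derivation
    -- of power series obey the same Leibniz rule for multiplication by polynomials in `λ`.
    have hdel (p : T.S) : Φ (Submodule.Quotient.mk (T.DLam p)) =
        PowerSeries.derivative ℂ (Φ (Submodule.Quotient.mk p)) := by
      have hp : p ∈ Submodule.span (Polynomial ℂ) (Set.range (monM (Polynomial ℂ))) := by
        rw [span_monM]; trivial
      induction hp using Submodule.span_induction with
      | mem p hp =>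
        obtain ⟨u, rfl⟩ := hp
        rw [DLam_monM]
        refine Eq.trans ?_ (h u).symm
        rw [← map_nsmul, ← map_neg]
        rfl
      | zero => simp
      | add p q _ _ hp hq => simp only [map_add, Submodule.Quotient.mk_add, hp, hq]
      | smul r p _ hp =>
        rw [DLam_smul, Submodule.Quotient.mk_add, Submodule.Quotient.mk_smul,
          Submodule.Quotient.mk_smul, Submodule.Quotient.mk_smul, map_add, map_smul, map_smul,
          map_smul, hp, derivative_polynomial_smul]
    rw [RingHom.id_apply]
    induction D using Weyl.induction generalizing w with
    | lam => rw [lam_smul_W, map_smul, Weyl.lam_smul_powerSeries, X_smul_powerSeries]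
    | del =>
      obtain ⟨p, rfl⟩ := Submodule.Quotient.mk_surjective _ w
      rw [del_smul_W, hdel, Weyl.del_smul_powerSeries]
    | scalar c =>
      rw [algebraMap_smul_W, map_smul, Weyl.algebraMap_smul_powerSeries, C_smul_powerSeries]
    | add D E hD hE => rw [add_smul, add_smul, map_add, hD, hE]
    | mul D E hD hE => rw [mul_smul, mul_smul, hD, hE]

theorem relations_f_le_ker_iff (L : T.S →ₗ[Polynomial ℂ] PowerSeries ℂ) :
    relations T.f ≤ LinearMap.ker L ↔ ∀ j u,
      (T.co u.1 j : ℂ) • L (monM _ u) + (T.l j : ℂ) • (L (monM _ (u + T.aM j)) -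
        PowerSeries.X * L (monM _ (u + T.a0M))) = 0 := by
  rw [T.relations_le_ker_iff T.f_eq]
  refine forall₂_congr fun j u => ?_
  rw [relator, map_add, map_smul, map_smul, map_sub, map_smul, X_smul_powerSeries,
    ← Polynomial.C_eq_algebraMap, C_smul_powerSeries, ← map_natCast Polynomial.C,
    C_smul_powerSeries]

/-! ### Formal solutions of `W` and functionals on `W_0` -/

/-- The coefficients of `exp(-ℓ_0 λ)`. -/
def expCoeff (k : ℕ) : ℂ := (-(T.l0 : ℂ)) ^ k / (k.factorial : ℂ)

theorem expCoeff_succ (k : ℕ) : T.expCoeff (k + 1) * (k + 1) = -(T.l0 : ℂ) * T.expCoeff k := by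
  have h : (k.factorial : ℂ) ≠ 0 := by exact_mod_cast k.factorial_ne_zero
  have h' : (k + 1 : ℂ) ≠ 0 := by exact_mod_cast k.succ_ne_zero
  rw [expCoeff, expCoeff, Nat.factorial_succ]
  push_cast
  field_simp
  ring

variable {T} in
/-- The values on the `x^u` of the solution attached to a functional on `W_0`. -/
def solutionValue (γ : T.W0 →ₗ[ℂ] ℂ) (u : T.M) : PowerSeries ℂ :=
  PowerSeries.mk fun k => T.expCoeff k * γ (T.w0 (u + k • T.a0M))

theorem l_mul_apply_w0 (γ : T.W0 →ₗ[ℂ] ℂ) (u : T.M) (j : Fin m) :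
    (T.l j : ℂ) * γ (T.w0 (u + T.aM j)) = -(T.co u.1 j : ℂ) * γ (T.w0 u) := by
  have h := T.l_ne_zero j
  rw [w0_add_a, map_smul, smul_eq_mul]
  field_simp

theorem co_add_nsmul_a0 (u : T.M) (k : ℕ) (j : Fin m) :
    (T.co (u + k • T.a0M).1 j : ℂ) = T.co u.1 j + k * (T.l j / T.l0) := by
  rw [show (u + k • T.a0M).1 = u.1 + k • T.a0 from rfl, map_add, map_nsmul, Pi.add_apply,
    Pi.smul_apply, co_a0, nsmul_eq_mul]
  push_cast
  rfl

/-- In the coefficient of `λ^k`, the recurrence of `W_0` at `u + k a_0` has the factor `u_j + k ℓ_j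
/ ℓ_0` in place of `u_j`. The excess `k ℓ_j / ℓ_0` is exactly what the term with `λ x^{u+a_0}`
supplies, since consecutive coefficients of `exp(-ℓ_0 λ)` have ratio `-ℓ_0 / k`. -/
theorem solutionValue_relation (γ : T.W0 →ₗ[ℂ] ℂ) (j : Fin m) (u : T.M) :
    (T.co u.1 j : ℂ) • solutionValue γ u + (T.l j : ℂ) • (solutionValue γ (u + T.aM j) -
      PowerSeries.X * solutionValue γ (u + T.a0M)) = 0 := by
  have hl := T.l0_ne_zero
  ext k
  have h1 := T.l_mul_apply_w0 γ (u + k • T.a0M) j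
  rw [add_right_comm, co_add_nsmul_a0] at h1
  cases k with
  | zero =>
    simp only [map_add, map_sub, PowerSeries.coeff_smul, solutionValue, PowerSeries.coeff_mk,
      PowerSeries.coeff_zero_X_mul, smul_eq_mul, map_zero, sub_zero]
    push_cast at h1
    linear_combination T.expCoeff 0 * h1
  | succ k =>
    simp only [map_add, map_sub, PowerSeries.coeff_smul, solutionValue, PowerSeries.coeff_mk,
      PowerSeries.coeff_succ_X_mul, smul_eq_mul, map_zero]
    rw [show u + T.a0M + k • T.a0M = u + (k + 1) • T.a0M by rw [succ_nsmul']; abel]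
    have h2 := T.expCoeff_succ k
    push_cast at h1
    generalize γ (T.w0 (u + (k + 1) • T.a0M)) = x at *
    generalize γ (T.w0 (u + T.aM j + (k + 1) • T.a0M)) = y at *
    have h3 : T.expCoeff k = - (T.expCoeff (k + 1) * (k + 1)) / T.l0 := by
      rw [h2]; field_simp
    rw [h3]
    linear_combination T.expCoeff (k + 1) * h1

theorem derivative_solutionValue (γ : T.W0 →ₗ[ℂ] ℂ) (u : T.M) :
    PowerSeries.derivative ℂ (solutionValue γ u) = -(T.l0 • solutionValue γ (u + T.a0M)) := by
  ext k
  rw [PowerSeries.coeff_derivative, map_neg, map_nsmul]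
  simp only [solutionValue, PowerSeries.coeff_mk, nsmul_eq_mul]
  rw [show u + T.a0M + k • T.a0M = u + (k + 1) • T.a0M by rw [succ_nsmul']; abel]
  linear_combination γ (T.w0 (u + (k + 1) • T.a0M)) * T.expCoeff_succ k

variable {T} in
/-- The solution attached to a functional on `W_0`, as a `ℂ[λ]`-linear map. -/
def solutionPoly (γ : T.W0 →ₗ[ℂ] ℂ) : T.W →ₗ[Polynomial ℂ] PowerSeries ℂ :=
  (relations T.f).liftQ (functional T.M (seriesOf (solutionValue γ))) <|
    (T.relations_f_le_ker_iff _).2 fun j u => by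
      simp only [functional_seriesOf]
      exact T.solutionValue_relation γ j u

theorem solutionPoly_w (γ : T.W0 →ₗ[ℂ] ℂ) (u : T.M) :
    solutionPoly γ (T.w u) = solutionValue γ u := functional_seriesOf _ _

variable {T} in
/-- The solution attached to a functional on `W_0`. -/
def solution (γ : T.W0 →ₗ[ℂ] ℂ) : T.W →ₗ[Weyl] PowerSeries ℂ :=
  T.weylLinear (solutionPoly γ) fun u => by
    rw [solutionPoly_w, solutionPoly_w, derivative_solutionValue]

theorem solution_w (γ : T.W0 →ₗ[ℂ] ℂ) (u : T.M) :
    solution γ (T.w u) = solutionValue γ u := T.solutionPoly_w γ u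

/-- The constant term of the solution at `x^u` is `γ(x^u)`, because `exp(-ℓ_0 λ)` has constant term
`1`. -/
theorem solution_injective : Function.Injective (solution (T := T)) := by
  intro γ γ' h
  refine T.W0_hom_ext fun u => ?_
  have h1 := congrArg (PowerSeries.coeff 0) (LinearMap.congr_fun h (T.w u))
  rw [solution_w, solution_w] at h1
  simpa [solutionValue, expCoeff] using h1

theorem derivative_apply_w (ψ : T.W →ₗ[Weyl] PowerSeries ℂ) (u : T.M) :
    PowerSeries.derivative ℂ (ψ (T.w u)) = -(T.l0 • ψ (T.w (u + T.a0M))) := by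
  rw [← Weyl.del_smul_powerSeries, ← map_smul, w, del_smul_W, DLam_monM, ← map_nsmul, ← map_neg]
  rfl

/-- Taylor's formula: each derivative in `λ` replaces `x^u` by `-ℓ_0 x^{u+a_0}`. -/
theorem coeff_apply_w (ψ : T.W →ₗ[Weyl] PowerSeries ℂ) (k : ℕ) (u : T.M) :
    PowerSeries.coeff k (ψ (T.w u)) =
      T.expCoeff k * PowerSeries.coeff 0 (ψ (T.w (u + k • T.a0M))) := by
  induction k generalizing u with
  | zero => simp [expCoeff]
  | succ k ih =>
    have h := congrArg (PowerSeries.coeff k) (T.derivative_apply_w ψ u)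
    have h' : (k + 1 : ℂ) ≠ 0 := by exact_mod_cast k.succ_ne_zero
    rw [PowerSeries.coeff_derivative, map_neg, map_nsmul, ih, nsmul_eq_mul,
      show u + T.a0M + k • T.a0M = u + (k + 1) • T.a0M by rw [succ_nsmul']; abel] at h
    refine mul_right_cancel₀ h' ?_
    rw [h]
    linear_combination
      -PowerSeries.coeff 0 (ψ (T.w (u + (k + 1) • T.a0M))) * T.expCoeff_succ k

/-- The preimage of `ψ` takes the constant terms of the `ψ(x^u)`. It respects the relations of `W_0`
because the term of the relation carrying `λ` has no constant term, and `coeff_apply_w` shows that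
`ψ` is rebuilt from it. -/
theorem solution_surjective : Function.Surjective (solution (T := T)) := by
  intro ψ
  have hrel := (T.relations_f_le_ker_iff ((polyLinear ψ).comp (relations T.f).mkQ)).1 (by
    intro p hp
    rw [LinearMap.mem_ker, LinearMap.comp_apply, Submodule.mkQ_apply,
      (Submodule.Quotient.mk_eq_zero _).2 hp, map_zero])
  let γ : T.W0 →ₗ[ℂ] ℂ := (relations T.f0).liftQ
    (functional T.M (seriesOf fun u => PowerSeries.coeff 0 (ψ (T.w u)))) <|
      (T.relations_f0_le_ker_iff _).2 fun j u => by
        have h : (T.co u.1 j : ℂ) • ψ (T.w u) + (T.l j : ℂ) • (ψ (T.w (u + T.aM j)) -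
          PowerSeries.X * ψ (T.w (u + T.a0M))) = 0 := hrel j u
        have h0 := congrArg (PowerSeries.coeff 0) h
        simp only [map_add, map_sub, PowerSeries.coeff_smul, PowerSeries.coeff_zero_X_mul,
          smul_eq_mul, map_zero, sub_zero] at h0
        rw [functional_seriesOf, functional_seriesOf]
        linear_combination h0
  have hγ (u : T.M) : γ (T.w0 u) = PowerSeries.coeff 0 (ψ (T.w u)) :=
    functional_seriesOf (fun u => PowerSeries.coeff 0 (ψ (T.w u))) u
  refine ⟨γ, T.solution_ext fun u => ?_⟩
  rw [solution_w]
  ext k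
  rw [solutionValue, PowerSeries.coeff_mk, hγ, ← coeff_apply_w]

/-- Functionals on `W_0` correspond to formal solutions of `W`. -/
def solutionEquiv : (T.W0 →ₗ[ℂ] ℂ) ≃ₗ[ℂ] (T.W →ₗ[Weyl] PowerSeries ℂ) :=
  LinearEquiv.ofBijective
    { toFun := solution
      map_add' := fun γ γ' => T.solution_ext fun u => by
        rw [LinearMap.add_apply, solution_w, solution_w, solution_w]
        ext k
        simp [solutionValue, mul_add]
      map_smul' := fun c γ => T.solution_ext fun u => by
        rw [RingHom.id_apply, LinearMap.smul_apply, solution_w, solution_w]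
        ext k
        simp [solutionValue, mul_left_comm] }
    ⟨T.solution_injective, T.solution_surjective⟩

/-- The coefficient of `λ^k` in the exponential series is supported at `x^{k a_0}` alone, so the
product reads off `g_b` at `-(u + k a_0)`. -/
theorem xi_neg (b : T.B) (u : T.M) : T.xi b (-u.1) = solutionValue (T.gammaW0 b) u := by
  rw [xi, gammaMinus, neg_neg, if_pos u.2, seriesMul, solutionValue]
  congr 1
  funext k
  rw [finsum_eq_single _ (k • T.a0) fun e he => by
    rw [PowerSeries.coeff_mul_C, expSeries, PowerSeries.coeff_mk, if_neg he, zero_mul],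
    PowerSeries.coeff_mul_C, expSeries, PowerSeries.coeff_mk, if_pos rfl, gammaW0_w0, expCoeff,
    show (u + k • T.a0M).1 = u.1 + k • T.a0 from rfl, neg_add, ← sub_eq_add_neg]

theorem solution_gammaW0 (b : T.B) (p : T.S) :
    solution (T.gammaW0 b) (Submodule.Quotient.mk p) = pairing (T.xi b) p.1 := by
  have h : (solutionPoly (T.gammaW0 b)).comp (relations T.f).mkQ = functional T.M (T.xi b) :=
    monAlg_hom_ext fun u => by
      rw [functional_monM, xi_neg]
      exact T.solutionPoly_w _ u
  exact LinearMap.congr_fun h p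

end Datum

end Delsarte

end

/-! ### The bases and the dimension -/

theorem corollary3p18 {n m : ℕ} (T : Delsarte.Datum n m) :
    -- the monomials `x^b` form a basis of `W_0`, and the `g_b` form the dual basis
    (∃ (x : Module.Basis T.B ℂ T.W0) (γ : Module.Basis T.B ℂ (T.W0 →ₗ[ℂ] ℂ)),
      (∀ b : T.B, x b = Submodule.Quotient.mk ⟨Delsarte.mon ℂ b.1,
        Delsarte.mon_mem (T.B_subset_M b.2)⟩) ∧
      (∀ (b : T.B) (p : T.S0), γ b (Submodule.Quotient.mk p) = Delsarte.pairing (T.g b) p.1) ∧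
      (∀ b, γ b (x b) = 1) ∧ (∀ b b', b ≠ b' → γ b (x b') = 0)) ∧
    -- the `ξ_b` form a basis of the space of formal solutions of `W`
    (∃ Ξ : Module.Basis T.B ℂ (T.W →ₗ[Delsarte.Weyl] PowerSeries ℂ),
      ∀ (b : T.B) (p : T.S),
        Ξ b (Submodule.Quotient.mk p) = Delsarte.pairing (T.xi b) p.1) ∧
    -- the dimension
    Module.rank ℂ (T.W →ₗ[Delsarte.Weyl] PowerSeries ℂ) = (T.ZA.relIndex T.VZ : Cardinal) ∧
    Nat.card T.B = T.ZA.relIndex T.VZ := by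
  refine ⟨⟨T.basisW0, T.dualBasisW0, T.basisW0_apply, fun b p => ?_, fun b => ?_,
    fun b b' h => ?_⟩, ⟨T.dualBasisW0.map T.solutionEquiv, fun b p => ?_⟩, ?_, T.card_B⟩
  · rw [T.dualBasisW0_apply]
    rfl
  · rw [T.dualBasisW0_apply, T.basisW0_apply, T.gammaW0_w0]
    exact T.g_neg_self b
  · rw [T.dualBasisW0_apply, T.basisW0_apply, T.gammaW0_w0]
    exact T.g_neg_of_ne h
  · rw [Module.Basis.map_apply, T.dualBasisW0_apply]
    exact T.solution_gammaW0 b p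
  · rw [← (T.dualBasisW0.map T.solutionEquiv).mk_eq_rank'', ← T.card_B, Nat.cast_card]
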